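/- A real random variable $Z$ is called sub-Gaussian with relative moment $\rho>0$ if $\mathbb{E}[\exp(tZ)]\le\exp(t^2\rho^2\,\mathbb{E}[Z^2]/2)$ for all $t\in\mathbb{R}$. A probability distribution $D_X$ over $\mathbb{R}^d$ is called a sub-Gaussian product distribution with relative moment $\rho$ if there is an orthonormal basis $a_1,\dots,a_d$ of $\mathbb{R}^d$ such that, for $X\sim D_X$, the random variables $\langle a_1,X\rangle,\dots,\langle a_d,X\rangle$ are independent and each is sub-Gaussian with relative moment $\rho$. For every $\rho>0$ and every $\delta\in(0,1)$ there are $\beta>0$ and $C>0$, depending only on $\rho$ and $\delta$, such that the following holds. Let $d$ be any dimension, let $D_X$ be any sub-Gaussian product distribution over $\mathbb{R}^d$ with relative moment $\rho$ whose covariance matrix $\Sigma$ satisfies $\Sigma\preceq I$ (that is, $I-\Sigma$ is positive semidefinite), and let $m$ be any non-negative integer with $m\le\beta\cdot\mathrm{tr}(\Sigma)-C$. Let $\mathbf{X}$ be the $m\times d$ matrix whose rows are $m$ independent samples drawn from $D_X$, and let $\lambda_{\min}(\mathbf{X}\mathbf{X}^T)$ be the smallest eigenvalue of its Gram matrix (taken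 to be $0$ if $m=0$). Then \[ \mathbb{P}\bigl[\lambda_{\min}(\mathbf{X}\mathbf{X}^T)\ge m\bigr]\ge\delta . \] -/

import Mathlib

open MeasureTheory ProbabilityTheory

noncomputable section

/-- The real random variable `X` is sub-Gaussian with moment `B ≥ 0`:
`E[exp (t X)]` is finite and at most `exp (t² B² / 2)` for every real `t`. -/
def IsSubGaussian {Ω : Type*} [MeasurableSpace Ω] (X : Ω → ℝ) (B : ℝ) (μ : Measure Ω) : Prop :=
  0 ≤ B ∧ HasSubgaussianMGF X (B ^ 2).toNNReal μ

/-- `X` is sub-Gaussian with relative moment `ρ`: it is sub-Gaussian with moment `ρ √E[X²]`. -/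
def IsRelSubGaussian {Ω : Type*} [MeasurableSpace Ω] (X : Ω → ℝ) (ρ : ℝ) (μ : Measure Ω) : Prop :=
  IsSubGaussian X (ρ * √(∫ ω, X ω ^ 2 ∂μ)) μ

/-- `μ` is a sub-Gaussian product distribution over `ℝ^d` with relative moment `ρ`: in some
orthonormal basis the coordinates of `X ∼ μ` are independent and sub-Gaussian with relative
moment `ρ`. -/
def IsSubGaussianProduct {d : ℕ} (ρ : ℝ) (μ : Measure (EuclideanSpace ℝ (Fin d))) : Prop :=
  ∃ a : OrthonormalBasis (Fin d) ℝ (EuclideanSpace ℝ (Fin d)),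
    iIndepFun (fun i x => inner ℝ (a i) x) μ ∧
      ∀ i, IsRelSubGaussian (fun x => inner ℝ (a i) x) ρ μ

/-- The covariance matrix of a distribution over `ℝ^d`. -/
def covMatrix {d : ℕ} (μ : Measure (EuclideanSpace ℝ (Fin d))) : Matrix (Fin d) (Fin d) ℝ :=
  Matrix.of fun i j => cov[fun x => x i, fun x => x j; μ]

/-- The `m × d` matrix whose rows are the `m` sample points. -/
def sampleMatrix {m d : ℕ} (x : Fin m → EuclideanSpace ℝ (Fin d)) : Matrix (Fin m) (Fin d) ℝ :=
  Matrix.of fun i j => x i j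

/-- The smallest real eigenvalue of a square matrix, used for symmetric matrices. A matrix of
size `0` gets the value `0`. -/
def lambdaMin {m : ℕ} (A : Matrix (Fin m) (Fin m) ℝ) : ℝ :=
  sInf {r : ℝ | Module.End.HasEigenvalue (Matrix.toLin' A) r}

end

/-!
Fix a unit vector `v`. The coordinates of the combination `∑ i, v i • x i` of the samples in the
good orthonormal basis are again independent, centered and relatively sub-Gaussian with the same
`ρ`, and they have the same second moments as the coordinates of a single sample, so the expected
squared norm of the combination is `tr Σ`. Decoupling with an independent Gaussian `g` turns
`𝔼 exp (s * X ^ 2) = 𝔼 exp (√(2 * s) * g * X)` into a Gaussian integral, which bounds the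
exponential moments of squares and hence their second moments. By Chernoff's method the squared
norm lies between `tr Σ / 4` and `4 * ρ ^ 2 * tr Σ` up to a probability exponentially small
in `tr Σ`. A union bound over an `ε`-net of the sphere, of size at most `(1 + 2 / ε) ^ m`, makes
this hold on the whole net; the upper bounds there control the operator norm, which extends the
lower bounds to the whole sphere and so bounds the smallest singular value from below.
-/

open scoped NNReal ENNReal

section SubgaussianSquare

variable {Ω : Type*} [MeasurableSpace Ω] {μ : Measure Ω} {X : Ω → ℝ} {c : ℝ≥0}

-- At `t = 0` the mgf touches the bound `exp (c t² / 2)` from below, so their derivatives agree.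
lemma integral_eq_zero_of_hasSubgaussianMGF [IsProbabilityMeasure μ]
    (h : HasSubgaussianMGF X c μ) : ∫ ω, X ω ∂μ = 0 := by
  have h0 : (0 : ℝ) ∈ interior (integrableExpSet X μ) := by simp [h.integrableExpSet_eq_univ]
  have hmgf : HasDerivAt (mgf X μ) (∫ ω, X ω ∂μ) 0 := by
    simpa using hasDerivAt_mgf h0
  have hexp : HasDerivAt (fun t : ℝ => Real.exp (c * t ^ 2 / 2)) 0 0 := by
    simpa using (((hasDerivAt_id (0 : ℝ)).pow 2).const_mul (c : ℝ)).div_const 2 |>.exp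
  have hmin : IsLocalMin (fun t => Real.exp (c * t ^ 2 / 2) - mgf X μ t) 0 :=
    .of_forall fun t => by simpa using h.mgf_le t
  simpa using hmin.hasDerivAt_eq_zero (hexp.sub hmgf)

lemma lintegral_exp_mul_sq_gaussianReal {a : ℝ} {v : ℝ≥0} (hav : a * v < 1) :
    ∫⁻ g, ENNReal.ofReal (Real.exp (a * g ^ 2 / 2)) ∂(gaussianReal 0 v)
      = ENNReal.ofReal (√(1 - a * v))⁻¹ := by
  rcases eq_or_ne v 0 with rfl | hv
  · simp
  have : (0 : ℝ) < v := by positivity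
  have hb : 0 < (1 - a * v) / (2 * v) := div_pos (by linarith) (by positivity)
  have hdensity (g : ℝ) : (gaussianPDF 0 v * fun g => ENNReal.ofReal (Real.exp (a * g ^ 2 / 2))) g
      = ENNReal.ofReal ((√(2 * Real.pi * v))⁻¹ * Real.exp (-((1 - a * v) / (2 * v)) * g ^ 2)) := by
    simp only [Pi.mul_apply, gaussianPDF, gaussianPDFReal]
    rw [← ENNReal.ofReal_mul (by positivity), mul_assoc, ← Real.exp_add]
    congr 3
    field_simp
    ring
  rw [gaussianReal_of_var_ne_zero _ hv,
    lintegral_withDensity_eq_lintegral_mul _ (measurable_gaussianPDF 0 v) (by fun_prop)]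
  simp_rw [hdensity]
  rw [← ofReal_integral_eq_lintegral_ofReal ((integrable_exp_neg_mul_sq hb).const_mul _)
    (.of_forall fun g => by positivity), integral_const_mul, integral_gaussian, ← Real.sqrt_inv,
    ← Real.sqrt_inv, ← Real.sqrt_mul (by positivity)]
  congr 2
  field_simp

lemma inv_sqrt_one_sub_le_exp {x : ℝ} (hx : 0 ≤ x) (hx' : x ≤ 1 / 2) :
    (√(1 - x))⁻¹ ≤ Real.exp x := by
  have hinv : (1 - x)⁻¹ ≤ Real.exp (2 * x) :=
    calc (1 - x)⁻¹ ≤ 1 + 2 * x := by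
          rw [inv_le_iff_one_le_mul₀ (by linarith)]
          nlinarith
      _ ≤ Real.exp (2 * x) := by linarith [Real.add_one_le_exp (2 * x)]
  rw [← Real.sqrt_inv, Real.sqrt_le_left (Real.exp_pos x).le, ← Real.exp_nat_mul]
  exact_mod_cast hinv

-- Writing `exp (s t²)` as the moment generating function at `t` of a Gaussian of variance `2 s`
-- reduces the square to the exponential moments of `X`.
lemma lintegral_exp_mul_sq_le_of_hasSubgaussianMGF [SFinite μ] (h : HasSubgaussianMGF X c μ)
    {s : ℝ} (hs : 0 ≤ s) (hsc : 2 * s * c < 1) :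
    ∫⁻ ω, ENNReal.ofReal (Real.exp (s * X ω ^ 2)) ∂μ
      ≤ ENNReal.ofReal (√(1 - 2 * s * c))⁻¹ := by
  lift s to ℝ≥0 using hs
  set γ := gaussianReal 0 (2 * s)
  have hgaussian (t : ℝ) : ENNReal.ofReal (Real.exp (s * t ^ 2))
      = ∫⁻ g, ENNReal.ofReal (Real.exp (t * g)) ∂γ := by
    have hmgf := congrFun (mgf_fun_id_gaussianReal (μ := 0) (v := 2 * s)) t
    rw [mgf] at hmgf
    rw [← ofReal_integral_eq_lintegral_ofReal (integrable_exp_mul_gaussianReal t)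
      (.of_forall fun g => by positivity), hmgf]
    congr 2
    push_cast
    ring
  have hX (g : ℝ) : ∫⁻ ω, ENNReal.ofReal (Real.exp (X ω * g)) ∂μ
      ≤ ENNReal.ofReal (Real.exp (c * g ^ 2 / 2)) := by
    simp_rw [mul_comm _ g]
    rw [← ofReal_integral_eq_lintegral_ofReal (h.integrable_exp_mul g)
      (.of_forall fun ω => by positivity)]
    exact ENNReal.ofReal_le_ofReal (h.mgf_le g)
  have hXg : AEMeasurable (fun p : Ω × ℝ => X p.1 * p.2) (μ.prod γ) :=
    h.aemeasurable.comp_fst.mul measurable_snd.aemeasurable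
  calc ∫⁻ ω, ENNReal.ofReal (Real.exp (s * X ω ^ 2)) ∂μ
      = ∫⁻ ω, ∫⁻ g, ENNReal.ofReal (Real.exp (X ω * g)) ∂γ ∂μ := by simp_rw [hgaussian]
    _ = ∫⁻ g, ∫⁻ ω, ENNReal.ofReal (Real.exp (X ω * g)) ∂μ ∂γ :=
        lintegral_lintegral_swap hXg.exp.ennreal_ofReal
    _ ≤ ∫⁻ g, ENNReal.ofReal (Real.exp (c * g ^ 2 / 2)) ∂γ := lintegral_mono hX
    _ = ENNReal.ofReal (√(1 - 2 * s * c))⁻¹ := by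
        rw [mul_comm] at hsc ⊢
        exact_mod_cast lintegral_exp_mul_sq_gaussianReal (v := 2 * s) (by exact_mod_cast hsc)

section

variable [SFinite μ] {s : ℝ}

lemma integrable_exp_mul_sq_of_hasSubgaussianMGF (h : HasSubgaussianMGF X c μ) (hs : 0 ≤ s)
    (hsc : 2 * s * c < 1) : Integrable (fun ω => Real.exp (s * X ω ^ 2)) μ :=
  (lintegral_ofReal_ne_top_iff_integrable
    ((h.aemeasurable.pow_const 2).const_mul s).exp.aestronglyMeasurable
    (.of_forall fun ω => by positivity)).1
    ((lintegral_exp_mul_sq_le_of_hasSubgaussianMGF h hs hsc).trans_lt ENNReal.ofReal_lt_top).ne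

lemma mgf_sq_le_of_hasSubgaussianMGF (h : HasSubgaussianMGF X c μ) (hs : 0 ≤ s)
    (hsc : 2 * s * c ≤ 1 / 2) : mgf (fun ω => X ω ^ 2) μ s ≤ Real.exp (2 * s * c) := by
  have hlt : 2 * s * c < 1 := by linarith
  have hle := lintegral_exp_mul_sq_le_of_hasSubgaussianMGF h hs hlt
  rw [← ofReal_integral_eq_lintegral_ofReal (integrable_exp_mul_sq_of_hasSubgaussianMGF h hs hlt)
    (.of_forall fun ω => by positivity)] at hle
  exact ((ENNReal.ofReal_le_ofReal_iff (by positivity)).1 hle).trans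
    (inv_sqrt_one_sub_le_exp (by positivity) hsc)

lemma integral_pow_four_le_of_hasSubgaussianMGF (h : HasSubgaussianMGF X c μ) :
    ∫ ω, X ω ^ 4 ∂μ ≤ 64 * c ^ 2 := by
  rcases eq_or_ne c 0 with rfl | hc
  · have hX : (fun ω => X ω ^ 4) =ᵐ[μ] 0 := by
      filter_upwards [h.ae_eq_zero_of_hasSubgaussianMGF_zero] with ω hω
      simp [hω]
    simp [integral_congr_ae hX]
  set s : ℝ := 1 / (4 * c) with hs
  have hs0 : 0 < s := by positivity
  have hsc : 2 * s * c = 1 / 2 := by rw [hs]; field_simp; norm_num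
  have hmgf : ∫ ω, Real.exp (s * X ω ^ 2) ∂μ ≤ 2 := by
    refine (mgf_sq_le_of_hasSubgaussianMGF h hs0.le hsc.le).trans ?_
    rw [hsc, Real.exp_half]
    exact Real.sqrt_le_iff.2 ⟨by norm_num, by linarith [Real.exp_one_lt_d9]⟩
  have hpow (ω : Ω) : X ω ^ 4 ≤ 2 / s ^ 2 * Real.exp (s * X ω ^ 2) := by
    have hexp := Real.quadratic_le_exp_of_nonneg (x := s * X ω ^ 2) (by positivity)
    rw [div_mul_eq_mul_div, le_div_iff₀ (by positivity)]
    nlinarith [show 0 ≤ s * X ω ^ 2 by positivity]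
  calc ∫ ω, X ω ^ 4 ∂μ ≤ ∫ ω, 2 / s ^ 2 * Real.exp (s * X ω ^ 2) ∂μ :=
        integral_mono_of_nonneg (.of_forall fun ω => by positivity)
          ((integrable_exp_mul_sq_of_hasSubgaussianMGF h hs0.le (by linarith)).const_mul _)
          (.of_forall hpow)
    _ = 2 / s ^ 2 * ∫ ω, Real.exp (s * X ω ^ 2) ∂μ := integral_const_mul _ _
    _ ≤ 2 / s ^ 2 * 2 := by gcongr
    _ = 64 * (c : ℝ) ^ 2 := by rw [hs]; field_simp; norm_num

end

lemma exp_neg_le_quadratic {y : ℝ} (hy : 0 ≤ y) : Real.exp (-y) ≤ 1 - y + y ^ 2 / 2 := by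
  have hpos : 0 < 1 - y + y ^ 2 / 2 := by nlinarith [sq_nonneg (y - 1)]
  rw [Real.exp_neg, inv_le_comm₀ (Real.exp_pos _) hpos]
  refine le_trans ?_ (Real.quadratic_le_exp_of_nonneg hy)
  rw [inv_le_iff_one_le_mul₀ hpos]
  nlinarith [sq_nonneg (y ^ 2)]

lemma mgf_sq_neg_le_of_hasSubgaussianMGF [IsProbabilityMeasure μ] (h : HasSubgaussianMGF X c μ)
    {t : ℝ} (ht : 0 ≤ t) :
    mgf (fun ω => X ω ^ 2) μ (-t)
      ≤ Real.exp (-(t * ∫ ω, X ω ^ 2 ∂μ) + 32 * t ^ 2 * c ^ 2) := by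
  have h2 : Integrable (fun ω => X ω ^ 2) μ := (h.memLp 2).integrable_sq
  have h4 : Integrable (fun ω => X ω ^ 4) μ := by
    simpa [Even.pow_abs (show Even 4 by decide)] using
      (h.memLp 4).integrable_norm_pow (by norm_num)
  have h1 : Integrable (fun ω => 1 - t * X ω ^ 2) μ := (integrable_const _).sub (h2.const_mul _)
  have hpt (ω : Ω) : Real.exp (-t * X ω ^ 2) ≤ 1 - t * X ω ^ 2 + t ^ 2 / 2 * X ω ^ 4 := by
    refine (neg_mul t _ ▸ exp_neg_le_quadratic (by positivity)).trans_eq ?_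
    ring
  calc mgf (fun ω => X ω ^ 2) μ (-t)
      ≤ ∫ ω, (1 - t * X ω ^ 2 + t ^ 2 / 2 * X ω ^ 4) ∂μ :=
        integral_mono_of_nonneg (.of_forall fun ω => by positivity)
          (h1.add (h4.const_mul _)) (.of_forall hpt)
    _ = 1 - t * ∫ ω, X ω ^ 2 ∂μ + t ^ 2 / 2 * ∫ ω, X ω ^ 4 ∂μ := by
        simp [integral_add h1 (h4.const_mul _), integral_sub (integrable_const _) (h2.const_mul _),
          integral_const_mul]
    _ ≤ 1 - t * ∫ ω, X ω ^ 2 ∂μ + t ^ 2 / 2 * (64 * c ^ 2) := by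
        gcongr
        exact integral_pow_four_le_of_hasSubgaussianMGF h
    _ = -(t * ∫ ω, X ω ^ 2 ∂μ) + 32 * t ^ 2 * c ^ 2 + 1 := by ring
    _ ≤ _ := Real.add_one_le_exp _

end SubgaussianSquare

section RelSubGaussian

variable {Ω Ω' ι : Type*} [MeasurableSpace Ω] [MeasurableSpace Ω'] {μ : Measure Ω} {ρ : ℝ}

lemma isRelSubGaussian_iff {X : Ω → ℝ} (hρ : 0 ≤ ρ) :
    IsRelSubGaussian X ρ μ ↔ HasSubgaussianMGF X (ρ ^ 2 * ∫ ω, X ω ^ 2 ∂μ).toNNReal μ := by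
  have hsq : (ρ * √(∫ ω, X ω ^ 2 ∂μ)) ^ 2 = ρ ^ 2 * ∫ ω, X ω ^ 2 ∂μ := by
    rw [mul_pow, Real.sq_sqrt (by positivity)]
  rw [IsRelSubGaussian, IsSubGaussian, hsq, and_iff_right (by positivity)]

lemma IsRelSubGaussian.memLp_two {X : Ω → ℝ} (h : IsRelSubGaussian X ρ μ) : MemLp X 2 μ :=
  h.2.memLp 2

lemma IsRelSubGaussian.integral_eq_zero [IsProbabilityMeasure μ] {X : Ω → ℝ}
    (h : IsRelSubGaussian X ρ μ) : ∫ ω, X ω ∂μ = 0 :=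
  integral_eq_zero_of_hasSubgaussianMGF h.2

lemma IsRelSubGaussian.const_mul {X : Ω → ℝ} (hρ : 0 ≤ ρ) (h : IsRelSubGaussian X ρ μ) (r : ℝ) :
    IsRelSubGaussian (fun ω => r * X ω) ρ μ := by
  rw [isRelSubGaussian_iff hρ] at h ⊢
  simp only [mul_pow, integral_const_mul]
  rw [mul_left_comm, Real.toNNReal_mul (sq_nonneg r), Real.toNNReal_of_nonneg (sq_nonneg r)]
  exact h.const_mul r

lemma IsRelSubGaussian.comp_measurePreserving {X : Ω → ℝ} {ν : Measure Ω'} {f : Ω' → Ω}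
    (h : IsRelSubGaussian X ρ μ) (hf : MeasurePreserving f ν μ) :
    IsRelSubGaussian (fun ω => X (f ω)) ρ ν := by
  have hX := h.2.aemeasurable
  have hsq : ∫ ω, X (f ω) ^ 2 ∂ν = ∫ ω, X ω ^ 2 ∂μ := by
    rw [← hf.map_eq] at hX ⊢
    exact (integral_map hf.aemeasurable (hX.pow_const 2).aestronglyMeasurable).symm
  rw [IsRelSubGaussian, hsq]
  exact ⟨h.1, .of_map hf.aemeasurable (hf.map_eq.symm ▸ h.2)⟩

lemma integral_sq_sum_of_iIndepFun [Fintype ι] [IsProbabilityMeasure μ] {X : ι → Ω → ℝ}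
    (hind : iIndepFun X μ) (hX : ∀ i, MemLp (X i) 2 μ) (h0 : ∀ i, ∫ ω, X i ω ∂μ = 0) :
    ∫ ω, (∑ i, X i ω) ^ 2 ∂μ = ∑ i, ∫ ω, X i ω ^ 2 ∂μ := by
  have hvar := IndepFun.variance_sum (s := Finset.univ) (fun i _ => hX i)
    fun i _ j _ hij => hind.indepFun hij
  have hmean : ∫ ω, (∑ i, X i) ω ∂μ = 0 := by
    simp [integral_finsetSum _ fun i _ => (hX i).integrable one_le_two, h0]
  rw [variance_of_integral_eq_zero
    (Finset.aemeasurable_sum _ fun i _ => (hX i).aemeasurable) hmean] at hvar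
  simpa [variance_of_integral_eq_zero (hX _).aemeasurable (h0 _)] using hvar

-- Both the sub-Gaussian parameter and the second moment add up over an independent sum.
lemma IsRelSubGaussian.sum [Fintype ι] [IsProbabilityMeasure μ] {X : ι → Ω → ℝ} (hρ : 0 ≤ ρ)
    (hind : iIndepFun X μ) (h : ∀ i, IsRelSubGaussian (X i) ρ μ) :
    IsRelSubGaussian (fun ω => ∑ i, X i ω) ρ μ := by
  have hsum := HasSubgaussianMGF.sum_of_iIndepFun hind (s := Finset.univ)
    fun i _ => (isRelSubGaussian_iff hρ).1 (h i)
  rw [isRelSubGaussian_iff hρ, integral_sq_sum_of_iIndepFun hind (fun i => (h i).memLp_two)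
    fun i => (h i).integral_eq_zero, Finset.mul_sum,
    Real.toNNReal_sum_of_nonneg fun i _ => by positivity]
  exact hsum

end RelSubGaussian

section ChernoffBound

variable {Ω κ : Type*} [MeasurableSpace Ω] [Fintype κ] {μ : Measure Ω} {Y : κ → Ω → ℝ} {t : ℝ}
  {b : κ → ℝ}

lemma integrable_exp_mul_sum_of_iIndepFun (hind : iIndepFun Y μ) (hm : ∀ j, AEMeasurable (Y j) μ)
    (hint : ∀ j, Integrable (fun ω => Real.exp (t * Y j ω)) μ) :
    Integrable (fun ω => Real.exp (t * (∑ j, Y j) ω)) μ := by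
  have := hind.isProbabilityMeasure
  rw [← mgf_pos_iff, hind.mgf_sum₀ hm]
  exact Finset.prod_pos fun j _ => mgf_pos (hint j)

lemma mgf_sum_le_exp_of_iIndepFun (hind : iIndepFun Y μ) (hm : ∀ j, AEMeasurable (Y j) μ)
    (hb : ∀ j, mgf (Y j) μ t ≤ Real.exp (b j)) :
    mgf (∑ j, Y j) μ t ≤ Real.exp (∑ j, b j) := by
  rw [hind.mgf_sum₀ hm, Real.exp_sum]
  exact Finset.prod_le_prod (fun j _ => mgf_nonneg) fun j _ => hb j

lemma measureReal_sum_ge_le_of_mgf_le (hind : iIndepFun Y μ) (hm : ∀ j, AEMeasurable (Y j) μ)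
    (hint : ∀ j, Integrable (fun ω => Real.exp (t * Y j ω)) μ)
    (hb : ∀ j, mgf (Y j) μ t ≤ Real.exp (b j)) (ht : 0 ≤ t) (r : ℝ) :
    μ.real {ω | r ≤ ∑ j, Y j ω} ≤ Real.exp (-t * r + ∑ j, b j) := by
  have := hind.isProbabilityMeasure
  simpa [Real.exp_add] using
    (measure_ge_le_exp_mul_mgf r ht (integrable_exp_mul_sum_of_iIndepFun hind hm hint)).trans
      (mul_le_mul_of_nonneg_left (mgf_sum_le_exp_of_iIndepFun hind hm hb) (Real.exp_pos _).le)

lemma measureReal_sum_le_le_of_mgf_le (hind : iIndepFun Y μ) (hm : ∀ j, AEMeasurable (Y j) μ)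
    (hint : ∀ j, Integrable (fun ω => Real.exp (t * Y j ω)) μ)
    (hb : ∀ j, mgf (Y j) μ t ≤ Real.exp (b j)) (ht : t ≤ 0) (r : ℝ) :
    μ.real {ω | ∑ j, Y j ω ≤ r} ≤ Real.exp (-t * r + ∑ j, b j) := by
  have := hind.isProbabilityMeasure
  simpa [Real.exp_add] using
    (measure_le_le_exp_mul_mgf r ht (integrable_exp_mul_sum_of_iIndepFun hind hm hint)).trans
      (mul_le_mul_of_nonneg_left (mgf_sum_le_exp_of_iIndepFun hind hm hb) (Real.exp_pos _).le)

end ChernoffBound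

/-- The rate `r` for which a sum of squares of independent variables, sub-Gaussian with relative
moment `ρ` and of second moment at most `K`, leaves constant multiples of its mean `Q` with
probability at most `2 * exp (-r * (Q / K))`. The two entries of the minimum are the rates of the
upper and the lower tail. -/
noncomputable def concentrationRate (ρ : ℝ) : ℝ :=
  min (1 / 2) (1 / (256 * ρ ^ 4))

lemma concentrationRate_pos {ρ : ℝ} (hρ : 0 < ρ) : 0 < concentrationRate ρ := by
  rw [concentrationRate]
  positivity

section Concentration

variable {Ω κ : Type*} [MeasurableSpace Ω] [Fintype κ] {μ : Measure Ω} {S : κ → Ω → ℝ} {ρ K : ℝ}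

lemma measureReal_sum_sq_ge_le (hρ : 0 < ρ) (hK : 0 < K) (hind : iIndepFun S μ)
    (hS : ∀ j, IsRelSubGaussian (S j) ρ μ) (hle : ∀ j, ∫ ω, S j ω ^ 2 ∂μ ≤ K) :
    μ.real {ω | 4 * ρ ^ 2 * ∑ j, ∫ ω, S j ω ^ 2 ∂μ ≤ ∑ j, S j ω ^ 2}
      ≤ Real.exp (-(1 / 2) * ((∑ j, ∫ ω, S j ω ^ 2 ∂μ) / K)) := by
  have := hind.isProbabilityMeasure
  set s : ℝ := 1 / (4 * ρ ^ 2 * K) with hs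
  have hs0 : 0 ≤ s := by positivity
  have hsub := fun j => (isRelSubGaussian_iff hρ.le).1 (hS j)
  have hparam (j : κ) : 2 * s * (ρ ^ 2 * ∫ ω, S j ω ^ 2 ∂μ).toNNReal
      = 1 / 2 * ((∫ ω, S j ω ^ 2 ∂μ) / K) := by
    rw [Real.coe_toNNReal _ (by positivity), hs]
    field_simp
    ring
  have hhalf (j : κ) : 2 * s * (ρ ^ 2 * ∫ ω, S j ω ^ 2 ∂μ).toNNReal ≤ 1 / 2 := by
    have := (div_le_one hK).2 (hle j)
    linarith [hparam j]
  refine (measureReal_sum_ge_le_of_mgf_le (hind.comp (fun _ y => y ^ 2) fun _ => by fun_prop)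
    (fun j => (hsub j).aemeasurable.pow_const 2)
    (fun j => integrable_exp_mul_sq_of_hasSubgaussianMGF (hsub j) hs0 (by linarith [hhalf j]))
    (fun j => mgf_sq_le_of_hasSubgaussianMGF (hsub j) hs0 (hhalf j)) hs0 _).trans_eq ?_
  simp_rw [hparam, ← Finset.mul_sum, ← Finset.sum_div]
  rw [hs]
  congr 1
  field_simp
  ring

lemma measureReal_sum_sq_le_le (hρ : 0 < ρ) (hK : 0 < K) (hind : iIndepFun S μ)
    (hS : ∀ j, IsRelSubGaussian (S j) ρ μ) (hle : ∀ j, ∫ ω, S j ω ^ 2 ∂μ ≤ K) :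
    μ.real {ω | ∑ j, S j ω ^ 2 ≤ (∑ j, ∫ ω, S j ω ^ 2 ∂μ) / 4}
      ≤ Real.exp (-(1 / (256 * ρ ^ 4)) * ((∑ j, ∫ ω, S j ω ^ 2 ∂μ) / K)) := by
  have := hind.isProbabilityMeasure
  set t : ℝ := 1 / (64 * ρ ^ 4 * K) with ht
  have ht0 : 0 ≤ t := by positivity
  have hsub := fun j => (isRelSubGaussian_iff hρ.le).1 (hS j)
  have hint (j : κ) : Integrable (fun ω => Real.exp (-t * S j ω ^ 2)) μ := by
    refine .of_bound ((hsub j).aemeasurable.pow_const 2 |>.const_mul _).exp.aestronglyMeasurable 1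
      (.of_forall fun ω => ?_)
    rw [Real.norm_eq_abs, Real.abs_exp, Real.exp_le_one_iff, neg_mul, neg_nonpos]
    positivity
  have hmgf (j : κ) : mgf (fun ω => S j ω ^ 2) μ (-t)
      ≤ Real.exp (-(t / 2) * ∫ ω, S j ω ^ 2 ∂μ) := by
    refine (mgf_sq_neg_le_of_hasSubgaussianMGF (hsub j) ht0).trans (Real.exp_le_exp.2 ?_)
    rw [Real.coe_toNNReal _ (by positivity)]
    have : 0 ≤ ∫ ω, S j ω ^ 2 ∂μ := by positivity
    calc -(t * ∫ ω, S j ω ^ 2 ∂μ) + 32 * t ^ 2 * (ρ ^ 2 * ∫ ω, S j ω ^ 2 ∂μ) ^ 2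
        = -(t * ∫ ω, S j ω ^ 2 ∂μ)
          + t / 2 * ((∫ ω, S j ω ^ 2 ∂μ) * ((∫ ω, S j ω ^ 2 ∂μ) / K)) := by
          rw [ht]
          field_simp
          ring
      _ ≤ -(t * ∫ ω, S j ω ^ 2 ∂μ) + t / 2 * ((∫ ω, S j ω ^ 2 ∂μ) * 1) := by
          gcongr
          exact (div_le_one hK).2 (hle j)
      _ = -(t / 2) * ∫ ω, S j ω ^ 2 ∂μ := by ring
  refine (measureReal_sum_le_le_of_mgf_le (hind.comp (fun _ y => y ^ 2) fun _ => by fun_prop)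
    (fun j => (hsub j).aemeasurable.pow_const 2) hint hmgf (neg_nonpos.2 ht0) _).trans_eq ?_
  rw [← Finset.mul_sum, ht]
  congr 1
  field_simp
  ring

lemma measureReal_sum_sq_notMem_Icc_le (hρ : 0 < ρ) (hK : 0 < K) (hind : iIndepFun S μ)
    (hS : ∀ j, IsRelSubGaussian (S j) ρ μ) (hle : ∀ j, ∫ ω, S j ω ^ 2 ∂μ ≤ K) :
    μ.real {ω | ∑ j, S j ω ^ 2 ∉ Set.Icc ((∑ j, ∫ ω, S j ω ^ 2 ∂μ) / 4)
        (4 * ρ ^ 2 * ∑ j, ∫ ω, S j ω ^ 2 ∂μ)}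
      ≤ 2 * Real.exp (-concentrationRate ρ * ((∑ j, ∫ ω, S j ω ^ 2 ∂μ) / K)) := by
  have := hind.isProbabilityMeasure
  set Q := ∑ j, ∫ ω, S j ω ^ 2 ∂μ
  have : 0 ≤ Q / K := by positivity
  have hsplit : {ω | ∑ j, S j ω ^ 2 ∉ Set.Icc (Q / 4) (4 * ρ ^ 2 * Q)}
      ⊆ {ω | ∑ j, S j ω ^ 2 ≤ Q / 4} ∪ {ω | 4 * ρ ^ 2 * Q ≤ ∑ j, S j ω ^ 2} := fun ω hω => by
    simp only [Set.mem_ofPred_eq, Set.mem_Icc, not_and_or, not_le] at hω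
    exact hω.imp le_of_lt le_of_lt
  calc _ ≤ μ.real {ω | ∑ j, S j ω ^ 2 ≤ Q / 4} + μ.real {ω | 4 * ρ ^ 2 * Q ≤ ∑ j, S j ω ^ 2} :=
        (measureReal_mono hsplit).trans (measureReal_union_le _ _)
    _ ≤ Real.exp (-(1 / (256 * ρ ^ 4)) * (Q / K)) + Real.exp (-(1 / 2) * (Q / K)) :=
        add_le_add (measureReal_sum_sq_le_le hρ hK hind hS hle)
          (measureReal_sum_sq_ge_le hρ hK hind hS hle)
    _ ≤ Real.exp (-concentrationRate ρ * (Q / K)) + Real.exp (-concentrationRate ρ * (Q / K)) := by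
        gcongr
        exacts [min_le_right _ _, min_le_left _ _]
    _ = _ := (two_mul _).symm

end Concentration

section ProductMeasure

variable {Ω E ι κ 𝓨 : Type*} [MeasurableSpace Ω] [MeasurableSpace E] [MeasurableSpace 𝓨]

lemma iIndepFun_comp_measurePreserving {ν : Measure Ω} {μ : Measure E} {f : κ → E → 𝓨} {g : Ω → E}
    (hind : iIndepFun f μ) (hf : ∀ j, Measurable (f j)) (hg : MeasurePreserving g ν μ) :
    iIndepFun (fun j ω => f j (g ω)) ν := by
  rw [iIndepFun_iff_measure_inter_preimage_eq_mul] at hind ⊢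
  intro s A hA
  have hpre (j : κ) (hj : j ∈ s) : ν ((fun ω => f j (g ω)) ⁻¹' A j) = μ (f j ⁻¹' A j) :=
    hg.measure_preimage (hf j (hA j hj)).nullMeasurableSet
  rw [Finset.prod_congr rfl hpre, ← hind s hA, ← hg.measure_preimage
    (s.measurableSet_biInter fun j hj => hf j (hA j hj)).nullMeasurableSet]
  simp only [Set.preimage_iInter, Set.preimage_preimage]

lemma iIndepFun_curry_swap {P : Measure Ω} {X : ι → κ → Ω → 𝓨} (mX : ∀ i j, Measurable (X i j))
    (h : iIndepFun (fun (p : ι × κ) ω => X p.1 p.2 ω) P) :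
    iIndepFun (fun (j : κ) ω (i : ι) => X i j ω) P := by
  have := h.isProbabilityMeasure
  have hprob (j : κ) (i : ι) : IsProbabilityMeasure (P.map (X i j)) :=
    Measure.isProbabilityMeasure_map (mX i j).aemeasurable
  have hswap : iIndepFun (fun (p : κ × ι) ω => X p.2 p.1 ω) P := h.precomp Prod.swap_injective
  have hcol (j : κ) : iIndepFun (fun i ω => X i j ω) P :=
    h.precomp (Prod.mk_left_injective j)
  have hcurry := congrArg (Measure.map (MeasurableEquiv.curry κ ι 𝓨))
    (hswap.map_fun_eq_infinitePi_map (by fun_prop))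
  rw [Measure.map_map (by fun_prop) (by fun_prop),
    Measure.infinitePi_map_curry fun j i => P.map (X i j)] at hcurry
  rw [iIndepFun_iff_map_fun_eq_infinitePi_map (by fun_prop)]
  simp_rw [fun j => (hcol j).map_fun_eq_infinitePi_map (by fun_prop)]
  exact hcurry

variable [Fintype ι] {μ : Measure E} [IsProbabilityMeasure μ]

lemma iIndepFun_pi_tuple {f : κ → E → 𝓨} (hf : ∀ j, Measurable (f j)) (hind : iIndepFun f μ) :
    iIndepFun (fun j (x : ι → E) (i : ι) => f j (x i)) (Measure.pi fun _ => μ) := by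
  refine iIndepFun_curry_swap (X := fun i j (x : ι → E) => f j (x i)) (by fun_prop)
    (iIndepFun_uncurry' (by fun_prop) ?_ fun i =>
      iIndepFun_comp_measurePreserving hind hf (measurePreserving_eval (fun _ => μ) i))
  exact iIndepFun_pi (X := fun _ y j => f j y) fun _ => Measurable.aemeasurable (by fun_prop)

lemma iIndepFun_sum_mul_eval {f : κ → E → ℝ} (hf : ∀ j, Measurable (f j)) (hind : iIndepFun f μ)
    (v : ι → ℝ) :
    iIndepFun (fun j (x : ι → E) => ∑ i, v i * f j (x i)) (Measure.pi fun _ => μ) :=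
  (iIndepFun_pi_tuple hf hind).comp (fun _ z => ∑ i, v i * z i) fun _ => by fun_prop

lemma iIndepFun_mul_eval {f : E → ℝ} (hf : AEMeasurable f μ) (v : ι → ℝ) :
    iIndepFun (fun i (x : ι → E) => v i * f (x i)) (Measure.pi fun _ => μ) :=
  iIndepFun_pi (X := fun i y => v i * f y) fun i => hf.const_mul (v i)

lemma IsRelSubGaussian.sum_mul_eval {f : E → ℝ} {ρ : ℝ} (hρ : 0 ≤ ρ) (h : IsRelSubGaussian f ρ μ)
    (v : ι → ℝ) :
    IsRelSubGaussian (fun x : ι → E => ∑ i, v i * f (x i)) ρ (Measure.pi fun _ => μ) :=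
  .sum hρ (iIndepFun_mul_eval h.2.aemeasurable v) fun i =>
    (h.comp_measurePreserving (measurePreserving_eval (fun _ => μ) i)).const_mul hρ (v i)

lemma integral_sq_sum_mul_eval {f : E → ℝ} (hf : MemLp f 2 μ) (h0 : ∫ y, f y ∂μ = 0) (v : ι → ℝ) :
    ∫ x : ι → E, (∑ i, v i * f (x i)) ^ 2 ∂(Measure.pi fun _ => μ)
      = (∑ i, v i ^ 2) * ∫ y, f y ^ 2 ∂μ := by
  have hmean (i : ι) : ∫ x : ι → E, f (x i) ∂(Measure.pi fun _ => μ) = 0 := by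
    rw [integral_comp_eval hf.aestronglyMeasurable, h0]
  have hsq (i : ι) : ∫ x : ι → E, f (x i) ^ 2 ∂(Measure.pi fun _ => μ) = ∫ y, f y ^ 2 ∂μ :=
    integral_comp_eval (μ := fun _ : ι => μ) (i := i) (f := fun y => f y ^ 2)
      (hf.aestronglyMeasurable.pow 2)
  rw [integral_sq_sum_of_iIndepFun (iIndepFun_mul_eval hf.aemeasurable v)
    (fun i => (hf.comp_measurePreserving (measurePreserving_eval (fun _ => μ) i)).const_mul (v i))
    fun i => by rw [integral_const_mul, hmean, mul_zero], Finset.sum_mul]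
  simp_rw [mul_pow, integral_const_mul, hsq]

end ProductMeasure

section Net

open Metric Module

variable {E : Type*} [NormedAddCommGroup E] [NormedSpace ℝ E] [FiniteDimensional ℝ E]

open scoped Function in
lemma card_le_of_isSeparated_of_subset_closedBall {ε : ℝ≥0} (hε : 0 < ε) {R : ℝ} (hR : 0 ≤ R)
    {c : E} {N : Finset E} (hN : (N : Set E) ⊆ closedBall c R) (hsep : IsSeparated ε (N : Set E)) :
    (N.card : ℝ) ≤ (1 + 2 * R / ε) ^ finrank ℝ E := by
  borelize E
  let μ : Measure E := Measure.addHaar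
  have hε' : (0 : ℝ) < ε := hε
  have hdisj : (N : Set E).Pairwise (Disjoint on fun y => ball y (ε / 2 : ℝ)) := by
    intro y hy z hz hyz
    refine ball_disjoint_ball ?_
    have hlt : (ε : ℝ≥0∞) < edist y z := hsep hy hz hyz
    rw [edist_nndist, ENNReal.coe_lt_coe, ← NNReal.coe_lt_coe, coe_nndist] at hlt
    rw [add_halves]
    exact hlt.le
  have hsub : (⋃ y ∈ N, ball y (ε / 2 : ℝ)) ⊆ ball c (R + ε / 2) :=
    Set.iUnion₂_subset fun y hy => ball_subset_ball' (by linarith [mem_closedBall.1 (hN hy)])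
  have hvol : N.card * ENNReal.ofReal ((ε / 2 : ℝ) ^ finrank ℝ E) * μ (ball 0 1)
      ≤ ENNReal.ofReal ((R + ε / 2) ^ finrank ℝ E) * μ (ball 0 1) := by
    have := measure_mono (μ := μ) hsub
    rwa [measure_biUnion_finset hdisj fun _ _ => measurableSet_ball, Finset.sum_congr rfl
      fun y _ => μ.addHaar_ball_of_pos y (half_pos hε'), μ.addHaar_ball_of_pos c (by positivity),
      Finset.sum_const, nsmul_eq_mul, ← mul_assoc] at this
  have hcard := ENNReal.toReal_le_of_le_ofReal (by positivity) <|
    (ENNReal.mul_le_mul_iff_left (measure_ball_pos μ _ zero_lt_one).ne' measure_ball_lt_top.ne).1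
      hvol
  rw [ENNReal.toReal_mul, ENNReal.toReal_natCast, ENNReal.toReal_ofReal (by positivity),
    ← le_div_iff₀ (by positivity), ← div_pow] at hcard
  have hbase : 1 + 2 * R / ε = (R + ε / 2) / (ε / 2) := by
    field_simp
    ring
  rwa [hbase]

lemma exists_finset_isCover_of_subset_closedBall {ε : ℝ≥0} (hε : 0 < ε) {R : ℝ} (hR : 0 ≤ R)
    {c : E} {A : Set E} (hA : A ⊆ closedBall c R) :
    ∃ N : Finset E, (N : Set E) ⊆ A ∧ IsCover ε A (N : Set E) ∧
      (N.card : ℝ) ≤ (1 + 2 * R / ε) ^ finrank ℝ E := by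
  have hcard (N : Finset E) (hN : (N : Set E) ⊆ A) (hsep : IsSeparated ε (N : Set E)) :
      (N.card : ℝ) ≤ (1 + 2 * R / ε) ^ finrank ℝ E :=
    card_le_of_isSeparated_of_subset_closedBall hε hR (hN.trans hA) hsep
  obtain ⟨k, hk⟩ := exists_nat_gt ((1 + 2 * R / ε) ^ finrank ℝ E)
  have hfinite : packingNumber ε A ≤ k := by
    refine iSup₂_le fun C hC => iSup_le fun hsep => ?_
    by_contra! hlt
    obtain ⟨D, hDC, hD⟩ := Set.exists_subset_encard_eq hlt.le
    have hDfin : D.Finite := Set.finite_of_encard_eq_coe hD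
    refine hk.not_ge ?_
    have := hcard hDfin.toFinset (by simpa using hDC.trans hC) (by simpa using hsep.subset hDC)
    rw [hDfin.encard_eq_coe_toFinset_card, Nat.cast_inj] at hD
    rwa [hD] at this
  have hne : packingNumber ε A ≠ ⊤ := (hfinite.trans_lt (ENat.natCast_lt_top k)).ne
  have hN : (maximalSeparatedSet ε A).Finite := by
    rw [← Set.encard_ne_top_iff, encard_maximalSeparatedSet hne]
    exact hne
  refine ⟨hN.toFinset, ?_, ?_, hcard _ ?_ ?_⟩ <;> rw [hN.coe_toFinset]
  exacts [maximalSeparatedSet_subset, isCover_maximalSeparatedSet hne, maximalSeparatedSet_subset,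
    isSeparated_maximalSeparatedSet]

end Net

section SphereCover

open Metric

lemma exists_norm_sub_le_of_isCover {E : Type*} [SeminormedAddCommGroup E] {ε : ℝ≥0}
    {s N : Set E} (hN : IsCover ε s N) {u : E} (hu : u ∈ s) : ∃ v ∈ N, ‖u - v‖ ≤ ε := by
  simpa [dist_eq_norm] using isCover_iff_subset_iUnion_closedBall.1 hN hu

variable {E F : Type*} [NormedAddCommGroup E] [NormedSpace ℝ E] [NormedAddCommGroup F]
  [NormedSpace ℝ F] {ε : ℝ≥0} {N : Set E} {b : ℝ}

lemma opNorm_le_of_isCover_sphere (hN : IsCover ε (sphere 0 1) N) (hε : ε < 1) (hb : 0 ≤ b)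
    (T : E →L[ℝ] F) (hT : ∀ v ∈ N, ‖T v‖ ≤ b) : ‖T‖ ≤ b / (1 - ε) := by
  have hself : ‖T‖ ≤ b + ‖T‖ * ε := by
    refine T.opNorm_le_of_unit_norm (by positivity) fun u hu => ?_
    obtain ⟨v, hv, huv⟩ := exists_norm_sub_le_of_isCover hN (mem_sphere_zero_iff_norm.2 hu)
    calc ‖T u‖ = ‖T v + T (u - v)‖ := by rw [← map_add, add_sub_cancel]
      _ ≤ ‖T v‖ + ‖T (u - v)‖ := norm_add_le _ _
      _ ≤ b + ‖T‖ * ε := add_le_add (hT v hv) (T.le_opNorm_of_le huv)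
  rw [le_div_iff₀ (sub_pos.2 (by exact_mod_cast hε))]
  linarith

lemma le_norm_apply_of_isCover_sphere (hN : IsCover ε (sphere 0 1) N) (hε : ε < 1)
    (T : E →L[ℝ] F) {a : ℝ} (hlow : ∀ v ∈ N, a ≤ ‖T v‖) (hup : ∀ v ∈ N, ‖T v‖ ≤ b) {u : E}
    (hu : ‖u‖ = 1) : a - b / (1 - ε) * ε ≤ ‖T u‖ := by
  obtain ⟨v, hv, huv⟩ := exists_norm_sub_le_of_isCover hN (mem_sphere_zero_iff_norm.2 hu)
  have hb : 0 ≤ b := (norm_nonneg _).trans (hup v hv)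
  rw [sub_le_iff_le_add]
  calc a ≤ ‖T v‖ := hlow v hv
    _ = ‖T u - T (u - v)‖ := by rw [← map_sub, sub_sub_cancel]
    _ ≤ ‖T u‖ + ‖T (u - v)‖ := norm_sub_le _ _
    _ ≤ ‖T u‖ + b / (1 - ε) * ε := by
      gcongr
      exact T.le_of_opNorm_le_of_le (opNorm_le_of_isCover_sphere hN hε hb T hup) huv

/-- The mesh of the net of the unit sphere: fine enough that values of `‖T v‖²` between `Q / 4`
and `4 * ρ ^ 2 * Q` on the net force `Q / 16 ≤ ‖T u‖²` on the whole sphere. -/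
noncomputable def netScale (ρ : ℝ) : ℝ≥0 :=
  min (1 / 2) (1 / (16 * ρ)).toNNReal

lemma netScale_pos {ρ : ℝ} (hρ : 0 < ρ) : 0 < netScale ρ :=
  lt_min (by positivity) (Real.toNNReal_pos.2 (by positivity))

lemma netScale_le_half (ρ : ℝ) : (netScale ρ : ℝ) ≤ 1 / 2 := by
  exact_mod_cast min_le_left (1 / 2 : ℝ≥0) (1 / (16 * ρ)).toNNReal

lemma netScale_mul_le {ρ : ℝ} (hρ : 0 < ρ) : (netScale ρ : ℝ) * (16 * ρ) ≤ 1 := by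
  rw [← le_div_iff₀ (by positivity), ← Real.coe_toNNReal (1 / (16 * ρ)) (by positivity)]
  exact_mod_cast min_le_right (1 / 2 : ℝ≥0) (1 / (16 * ρ)).toNNReal

lemma div_sixteen_le_norm_apply_sq_of_isCover_netScale {ρ : ℝ} (hρ : 0 < ρ) {Q : ℝ}
    (hN : IsCover (netScale ρ) (sphere 0 1) N) (T : E →L[ℝ] F)
    (hT : ∀ v ∈ N, ‖T v‖ ^ 2 ∈ Set.Icc (Q / 4) (4 * ρ ^ 2 * Q)) {u : E} (hu : ‖u‖ = 1) :
    Q / 16 ≤ ‖T u‖ ^ 2 := by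
  have hlow (v : E) (hv : v ∈ N) : √Q / 2 ≤ ‖T v‖ := by
    rw [div_le_iff₀ two_pos, Real.sqrt_le_left (by positivity)]
    linarith [(hT v hv).1]
  have hup (v : E) (hv : v ∈ N) : ‖T v‖ ≤ 2 * ρ * √Q := by
    have := Real.le_sqrt_of_sq_le (hT v hv).2
    rwa [show 4 * ρ ^ 2 * Q = (2 * ρ) ^ 2 * Q by ring, Real.sqrt_mul (by positivity),
      Real.sqrt_sq (by positivity)] at this
  have hhalf := netScale_le_half ρ
  have hlt : netScale ρ < 1 := by exact_mod_cast hhalf.trans_lt one_half_lt_one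
  have hosc : 2 * ρ * √Q / (1 - netScale ρ) * netScale ρ ≤ √Q / 4 := by
    rw [div_mul_eq_mul_div, div_le_iff₀ (by linarith)]
    nlinarith [netScale_mul_le hρ, Real.sqrt_nonneg Q]
  have hsqrt : √Q ≤ 4 * ‖T u‖ := by
    linarith [le_norm_apply_of_isCover_sphere hN hlt T hlow hup hu]
  rw [Real.sqrt_le_left (by positivity)] at hsqrt
  linarith

end SphereCover

section Gram

variable {ι E : Type*} [Fintype ι] [NormedAddCommGroup E] [InnerProductSpace ℝ E]

/-- The combination map `v ↦ ∑ i, v i • x i` of a family of vectors `x`, the transpose of the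
matrix with rows `x i`. It is a continuous linear map out of Euclidean space so that nets of the
unit sphere control its smallest singular value. -/
noncomputable def sampleCombination (x : ι → E) : EuclideanSpace ℝ ι →L[ℝ] E :=
  ∑ i, (EuclideanSpace.proj i : EuclideanSpace ℝ ι →L[ℝ] ℝ).smulRight (x i)

lemma sampleCombination_apply (x : ι → E) (v : EuclideanSpace ℝ ι) :
    sampleCombination x v = ∑ i, v i • x i := by
  simp [sampleCombination]

lemma inner_sampleCombination (b : E) (x : ι → E) (v : EuclideanSpace ℝ ι) :
    inner ℝ b (sampleCombination x v) = ∑ i, v i * inner ℝ b (x i) := by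
  simp only [sampleCombination_apply, inner_sum, real_inner_smul_right]

lemma dotProduct_gram_mulVec (x : ι → E) (v : EuclideanSpace ℝ ι) :
    (v : ι → ℝ) ⬝ᵥ (Matrix.gram ℝ x).mulVec v = ‖sampleCombination x v‖ ^ 2 := by
  rw [← real_inner_self_eq_norm_sq, sampleCombination_apply]
  exact Matrix.star_dotProduct_gram_mulVec x v v

end Gram

section LambdaMin

variable {m : ℕ}

lemma sampleMatrix_mul_transpose {d : ℕ} (x : Fin m → EuclideanSpace ℝ (Fin d)) :
    sampleMatrix x * (sampleMatrix x).transpose = Matrix.gram ℝ x := by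
  ext i j
  simp [sampleMatrix, Matrix.mul_apply, PiLp.inner_apply, mul_comm]

lemma lambdaMin_eq_iInf_eigenvalues {A : Matrix (Fin m) (Fin m) ℝ} (hA : A.IsHermitian) :
    lambdaMin A = ⨅ i, hA.eigenvalues i := by
  rw [lambdaMin, iInf, ← hA.spectrum_real_eq_range_eigenvalues, ← Matrix.spectrum_toLin']
  simp only [Module.End.hasEigenvalue_iff_mem_spectrum, Set.ofPred_mem_eq]

lemma le_lambdaMin {A : Matrix (Fin m) (Fin m) ℝ} (hA : A.IsHermitian) {r : ℝ}
    (hr : m = 0 → r ≤ 0)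
    (h : ∀ v : EuclideanSpace ℝ (Fin m), ‖v‖ = 1 → r ≤ (v : Fin m → ℝ) ⬝ᵥ A.mulVec v) :
    r ≤ lambdaMin A := by
  rw [lambdaMin_eq_iInf_eigenvalues hA]
  cases m with
  | zero => simpa only [Real.iInf_of_isEmpty] using hr rfl
  | succ m =>
    refine le_ciInf fun i => ?_
    rw [hA.eigenvalues_eq]
    exact h _ (hA.eigenvectorBasis.norm_eq_one i)

lemma le_lambdaMin_gram_of_isCover_netScale {E : Type*} [NormedAddCommGroup E]
    [InnerProductSpace ℝ E] {ρ : ℝ} (hρ : 0 < ρ) {Q r : ℝ} {N : Set (EuclideanSpace ℝ (Fin m))}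
    (hN : Metric.IsCover (netScale ρ) (Metric.sphere 0 1) N) (x : Fin m → E)
    (hx : ∀ v ∈ N, ‖sampleCombination x v‖ ^ 2 ∈ Set.Icc (Q / 4) (4 * ρ ^ 2 * Q))
    (hr : m = 0 → r ≤ 0) (hrQ : r ≤ Q / 16) : r ≤ lambdaMin (Matrix.gram ℝ x) := by
  refine le_lambdaMin (Matrix.isHermitian_gram ℝ x) hr fun u hu => ?_
  rw [dotProduct_gram_mulVec]
  exact hrQ.trans (div_sixteen_le_norm_apply_sq_of_isCover_netScale hρ hN _ hx hu)

end LambdaMin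

section Covariance

lemma trace_eq_sum_dotProduct_mulVec {ι κ : Type*} [Fintype ι] [Fintype κ]
    (a : OrthonormalBasis κ ℝ (EuclideanSpace ℝ ι)) (A : Matrix ι ι ℝ) :
    A.trace = ∑ j, (a j : ι → ℝ) ⬝ᵥ A.mulVec (a j) := by
  classical
  rw [← Matrix.trace_toLin_eq A (EuclideanSpace.basisFun ι ℝ).toBasis,
    ← Matrix.toEuclideanLin_eq_toLin_orthonormal, LinearMap.trace_eq_sum_inner _ a]
  refine Finset.sum_congr rfl fun j _ => ?_
  rw [EuclideanSpace.inner_eq_star_dotProduct, star_trivial, Matrix.ofLp_toLpLin,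
    Matrix.toLin'_apply, dotProduct_comm]

variable {d : ℕ} {μ : Measure (EuclideanSpace ℝ (Fin d))}
  (a : OrthonormalBasis (Fin d) ℝ (EuclideanSpace ℝ (Fin d)))

lemma memLp_apply_of_memLp_inner_basis {p : ℝ≥0∞} (h : ∀ j, MemLp (fun x => inner ℝ (a j) x) p μ)
    (i : Fin d) : MemLp (fun x => x i) p μ := by
  have hcoord (x : EuclideanSpace ℝ (Fin d)) : x i = ∑ j, a j i * inner ℝ (a j) x := by
    conv_lhs => rw [← a.sum_repr' x]
    simp [mul_comm]
  rw [funext hcoord]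
  exact memLp_finsetSum _ fun j _ => (h j).const_mul _

variable [IsFiniteMeasure μ]

lemma dotProduct_covMatrix_mulVec (h : ∀ i, MemLp (fun x => x i) 2 μ)
    (b : EuclideanSpace ℝ (Fin d)) :
    (b : Fin d → ℝ) ⬝ᵥ (covMatrix μ).mulVec b = Var[fun x => inner ℝ b x; μ] := by
  have hb : (fun x : EuclideanSpace ℝ (Fin d) => inner ℝ b x) = fun x => ∑ i, b i * x i := by
    ext x
    simp [PiLp.inner_apply, mul_comm]
  rw [hb, ← covariance_self (by fun_prop),
    covariance_fun_sum_fun_sum (fun i => (h i).const_mul _) (fun i => (h i).const_mul _)]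
  simp only [dotProduct, Matrix.mulVec, covMatrix, Matrix.of_apply, Finset.mul_sum,
    covariance_const_mul_left, covariance_const_mul_right]
  exact Finset.sum_congr rfl fun i _ => Finset.sum_congr rfl fun j _ => by ring

lemma trace_covMatrix_eq_sum_variance (h : ∀ i, MemLp (fun x => x i) 2 μ) :
    (covMatrix μ).trace = ∑ j, Var[fun x => inner ℝ (a j) x; μ] := by
  simp_rw [trace_eq_sum_dotProduct_mulVec a, dotProduct_covMatrix_mulVec h]

lemma variance_inner_le_one (h : ∀ i, MemLp (fun x => x i) 2 μ)
    (hcov : (1 - covMatrix μ).PosSemidef) {b : EuclideanSpace ℝ (Fin d)} (hb : ‖b‖ = 1) :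
    Var[fun x => inner ℝ b x; μ] ≤ 1 := by
  have hquad := hcov.dotProduct_mulVec_nonneg (b : Fin d → ℝ)
  have hbb : (b : Fin d → ℝ) ⬝ᵥ (b : Fin d → ℝ) = 1 := by
    have := EuclideanSpace.inner_eq_star_dotProduct b b
    rwa [star_trivial, real_inner_self_eq_norm_sq, hb, one_pow, eq_comm] at this
  rw [star_trivial, Matrix.sub_mulVec, Matrix.one_mulVec, dotProduct_sub, hbb,
    dotProduct_covMatrix_mulVec h] at hquad
  linarith

end Covariance

section SampleConcentration

variable {E κ : Type*} [NormedAddCommGroup E] [InnerProductSpace ℝ E] [MeasurableSpace E]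
  [BorelSpace E] [Fintype κ] {μ : Measure E} {a : OrthonormalBasis κ ℝ E} {ρ K : ℝ}

lemma measureReal_norm_sampleCombination_sq_notMem_Icc_le {ι : Type*} [Fintype ι] (hρ : 0 < ρ)
    (hK : 0 < K) (hind : iIndepFun (fun j y => inner ℝ (a j) y) μ)
    (hsub : ∀ j, IsRelSubGaussian (fun y => inner ℝ (a j) y) ρ μ)
    (hle : ∀ j, ∫ y, inner ℝ (a j) y ^ 2 ∂μ ≤ K) {v : EuclideanSpace ℝ ι} (hv : ‖v‖ = 1) :
    (Measure.pi fun _ => μ).real {x : ι → E | ‖sampleCombination x v‖ ^ 2 ∉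
        Set.Icc ((∑ j, ∫ y, inner ℝ (a j) y ^ 2 ∂μ) / 4)
          (4 * ρ ^ 2 * ∑ j, ∫ y, inner ℝ (a j) y ^ 2 ∂μ)}
      ≤ 2 * Real.exp (-concentrationRate ρ * ((∑ j, ∫ y, inner ℝ (a j) y ^ 2 ∂μ) / K)) := by
  have := hind.isProbabilityMeasure
  have hnorm (x : ι → E) :
      ‖sampleCombination x v‖ ^ 2 = ∑ j, (∑ i, v i * inner ℝ (a j) (x i)) ^ 2 := by
    simp only [← a.sum_sq_inner_right, inner_sampleCombination]
  have hsq (j : κ) : ∫ x : ι → E, (∑ i, v i * inner ℝ (a j) (x i)) ^ 2 ∂(Measure.pi fun _ => μ)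
      = ∫ y, inner ℝ (a j) y ^ 2 ∂μ := by
    rw [integral_sq_sum_mul_eval (hsub j).memLp_two (hsub j).integral_eq_zero,
      ← EuclideanSpace.real_norm_sq_eq, hv, one_pow, one_mul]
  have hconc := measureReal_sum_sq_notMem_Icc_le hρ hK
    (iIndepFun_sum_mul_eval (fun j => by fun_prop) hind v)
    (fun j => (hsub j).sum_mul_eval hρ.le v) fun j => (hsq j).trans_le (hle j)
  simpa only [hnorm, hsq] using hconc

lemma measureReal_lambdaMin_gram_lt_le {m : ℕ} (hρ : 0 < ρ)
    (hK : 0 < K) (hind : iIndepFun (fun j y => inner ℝ (a j) y) μ)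
    (hsub : ∀ j, IsRelSubGaussian (fun y => inner ℝ (a j) y) ρ μ)
    (hle : ∀ j, ∫ y, inner ℝ (a j) y ^ 2 ∂μ ≤ K) {r : ℝ} (hr : m = 0 → r ≤ 0)
    (hrQ : r ≤ (∑ j, ∫ y, inner ℝ (a j) y ^ 2 ∂μ) / 16) :
    (Measure.pi fun _ => μ).real {x : Fin m → E | lambdaMin (Matrix.gram ℝ x) < r}
      ≤ (1 + 2 / netScale ρ) ^ m *
        (2 * Real.exp (-concentrationRate ρ * ((∑ j, ∫ y, inner ℝ (a j) y ^ 2 ∂μ) / K))) := by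
  have := hind.isProbabilityMeasure
  set Q := ∑ j, ∫ y, inner ℝ (a j) y ^ 2 ∂μ
  let bad (v : EuclideanSpace ℝ (Fin m)) : Set (Fin m → E) :=
    {x | ‖sampleCombination x v‖ ^ 2 ∉ Set.Icc (Q / 4) (4 * ρ ^ 2 * Q)}
  obtain ⟨N, hNsphere, hNcover, hNcard⟩ := exists_finset_isCover_of_subset_closedBall
    (netScale_pos hρ) zero_le_one
    (Metric.sphere_subset_closedBall (x := (0 : EuclideanSpace ℝ (Fin m))))
  rw [mul_one, finrank_euclideanSpace_fin] at hNcard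
  have hcover : {x : Fin m → E | lambdaMin (Matrix.gram ℝ x) < r} ⊆ ⋃ v ∈ N, bad v := by
    intro x hx
    contrapose! hx
    simp only [bad, Set.mem_iUnion, Set.mem_ofPred_eq, not_exists, not_not] at hx
    rw [Set.mem_ofPred_eq, not_lt]
    exact le_lambdaMin_gram_of_isCover_netScale hρ hNcover x hx hr hrQ
  calc (Measure.pi fun _ => μ).real {x : Fin m → E | lambdaMin (Matrix.gram ℝ x) < r}
      ≤ ∑ v ∈ N, (Measure.pi fun _ => μ).real (bad v) :=
        (measureReal_mono hcover (measure_ne_top _ _)).trans (measureReal_biUnion_finset_le _ _)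
    _ ≤ N.card • (2 * Real.exp (-concentrationRate ρ * (Q / K))) :=
        Finset.sum_le_card_nsmul _ _ _ fun v hv =>
          measureReal_norm_sampleCombination_sq_notMem_Icc_le hρ hK hind hsub hle
            (mem_sphere_zero_iff_norm.1 (hNsphere hv))
    _ ≤ _ := by
        rw [nsmul_eq_mul]
        gcongr

end SampleConcentration

lemma IsSubGaussianProduct.measureReal_lambdaMin_lt_le {d m : ℕ} {ρ r : ℝ} (hρ : 0 < ρ)
    {μ : Measure (EuclideanSpace ℝ (Fin d))} (hμ : IsSubGaussianProduct ρ μ)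
    (hcov : (1 - covMatrix μ).PosSemidef) (hr : m = 0 → r ≤ 0)
    (hrL : r ≤ (covMatrix μ).trace / 16) :
    (Measure.pi fun _ : Fin m => μ).real
        {x | lambdaMin (sampleMatrix x * (sampleMatrix x).transpose) < r}
      ≤ (1 + 2 / netScale ρ) ^ m *
        (2 * Real.exp (-concentrationRate ρ * (covMatrix μ).trace)) := by
  obtain ⟨a, hind, hsub⟩ := hμ
  have := hind.isProbabilityMeasure
  have hLp := memLp_apply_of_memLp_inner_basis a fun j => (hsub j).memLp_two
  have hvar (j : Fin d) : Var[fun y => inner ℝ (a j) y; μ] = ∫ y, inner ℝ (a j) y ^ 2 ∂μ :=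
    variance_of_integral_eq_zero (hsub j).memLp_two.aemeasurable (hsub j).integral_eq_zero
  have hle (j : Fin d) : ∫ y, inner ℝ (a j) y ^ 2 ∂μ ≤ 1 :=
    hvar j ▸ variance_inner_le_one hLp hcov (a.norm_eq_one j)
  have htrace : (covMatrix μ).trace = ∑ j, ∫ y, inner ℝ (a j) y ^ 2 ∂μ := by
    simp_rw [trace_covMatrix_eq_sum_variance a hLp, hvar]
  rw [htrace] at hrL ⊢
  simp_rw [sampleMatrix_mul_transpose]
  simpa only [div_one] using
    measureReal_lambdaMin_gram_lt_le hρ one_pos hind hsub hle hr hrL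

section SampleSize

lemma exists_sampleSize_bound {κ c η : ℝ} (hκ : 1 < κ) (hc : 0 < c) (hη : 0 < η) :
    ∃ β > (0 : ℝ), ∃ C > (0 : ℝ), ∀ (m : ℕ) (L : ℝ), (m : ℝ) ≤ β * L - C →
      (m : ℝ) ≤ L / 16 ∧ κ ^ m * (2 * Real.exp (-c * L)) ≤ η := by
  have hlog : 0 < Real.log κ := Real.log_pos hκ
  have hη1 : 1 < 1 + 2 / η := lt_add_of_pos_right 1 (by positivity)
  refine ⟨min (1 / 16) (c / Real.log κ), by positivity, Real.log (1 + 2 / η) / Real.log κ,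
    div_pos (Real.log_pos hη1) hlog, fun m L hm => ?_⟩
  set C := Real.log (1 + 2 / η) / Real.log κ 
  have hC0 : 0 < C := div_pos (Real.log_pos hη1) hlog
  have hL : 0 < L := by
    refine pos_of_mul_pos_right (a := min (1 / 16) (c / Real.log κ)) ?_ (by positivity)
    linarith [(Nat.cast_nonneg m : (0 : ℝ) ≤ m)]
  have h16 : min (1 / 16) (c / Real.log κ) * L ≤ 1 / 16 * L := by
    gcongr
    exact min_le_left _ _
  have hrate : min (1 / 16) (c / Real.log κ) * L ≤ c / Real.log κ * L := by
    gcongr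
    exact min_le_right _ _
  refine ⟨by linarith, ?_⟩
  have hexp : m * Real.log κ - c * L ≤ -Real.log (1 + 2 / η) := by
    have hClog : C * Real.log κ = Real.log (1 + 2 / η) := div_mul_cancel₀ _ hlog.ne'
    calc m * Real.log κ - c * L ≤ (c / Real.log κ * L - C) * Real.log κ - c * L := by
          gcongr
          linarith
      _ = -Real.log (1 + 2 / η) := by
          rw [← hClog]
          field_simp
          ring
  calc κ ^ m * (2 * Real.exp (-c * L)) = 2 * Real.exp (m * Real.log κ - c * L) := by
        rw [sub_eq_add_neg, Real.exp_add, Real.exp_nat_mul, Real.exp_log (by linarith), neg_mul]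
        ring
    _ ≤ 2 * Real.exp (-Real.log (1 + 2 / η)) := by gcongr
    _ = 2 / (1 + 2 / η) := by rw [Real.exp_neg, Real.exp_log (by linarith), ← div_eq_mul_inv]
    _ ≤ η := by
        rw [div_le_iff₀ (by linarith)]
        field_simp
        linarith

end SampleSize

theorem mainTheorem4 (ρ : ℝ) (hρ : 0 < ρ) (δ : ℝ) (hδ : δ ∈ Set.Ioo (0 : ℝ) 1) :
    ∃ β > (0 : ℝ), ∃ C > (0 : ℝ),
      ∀ (d : ℕ) (μ : Measure (EuclideanSpace ℝ (Fin d))) [IsProbabilityMeasure μ],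
        IsSubGaussianProduct ρ μ →
        (1 - covMatrix μ).PosSemidef →
        ∀ m : ℕ, (m : ℝ) ≤ β * (covMatrix μ).trace - C →
          δ ≤ (Measure.pi fun _ : Fin m => μ).real
            {x | (m : ℝ) ≤ lambdaMin (sampleMatrix x * (sampleMatrix x).transpose)} := by
  have hnet : (0 : ℝ) < netScale ρ := netScale_pos hρ
  obtain ⟨β, hβ, C, hC, hsize⟩ := exists_sampleSize_bound (κ := 1 + 2 / netScale ρ)
    (lt_add_of_pos_right 1 (by positivity)) (concentrationRate_pos hρ) (sub_pos.2 hδ.2)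
  refine ⟨β, hβ, C, hC, fun d μ _ hμ hcov m hm => ?_⟩
  obtain ⟨hmL, hunion⟩ := hsize m _ hm
  have hbad := (hμ.measureReal_lambdaMin_lt_le hρ hcov
    (fun h => by rw [h, Nat.cast_zero]) hmL).trans hunion
  have hcover := measureReal_union_le (μ := Measure.pi fun _ : Fin m => μ)
    {x | (m : ℝ) ≤ lambdaMin (sampleMatrix x * (sampleMatrix x).transpose)}
    {x | (m : ℝ) ≤ lambdaMin (sampleMatrix x * (sampleMatrix x).transpose)}ᶜ
  rw [Set.union_compl_self, probReal_univ] at hcover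
  simp only [Set.compl_ofPred, not_le] at hcover
  linarith
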